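/- **Setting.** Let $K$ be a finite set and, for each $k\in K$, let $E_k\subseteq\mathbb R^{d(k)}$. The state space is the disjoint union $E=\bigcup_{k\in K}\{k\}\times E_k$ with the disjoint union topology and the $\sigma$-algebra generated by the sets $\{k\}\times B$, $B\subseteq E_k$ Borel. A *flow* on $A\subseteq\mathbb R^d$ is a continuous map $\phi:A\times\mathbb R\to\mathbb R^d$ with $\phi(x,0)=x$ and with $\phi(x,t+s)=\phi(\phi(x,t),s)$ whenever $\phi(x,t)\in A$ and $\phi(\phi(x,t),s)\in A$. Let $\partial^+_\phi A$ (resp. $\partial^-_\phi A$) be the set of points of $\partial A$ of the form $\phi(y,t)$ (resp. $\phi(y,-t)$) with $y\in A$, $t>0$ and $\phi(y,s)\in A^\circ$ (resp. $\phi(y,-s)\in A^\circ$) for all $s\in[0,t)$. *Local characteristics* $(\phi,\lambda,Q)$ on $E$ consist of flows $\phi_k$ on $E_k$ with $E_k=E_k^\circ\cup(\partial^-_{\phi_k}E_k\setminus\partial^+_{\phi_k}E_k)$, a bounded measurable intensity $\lambda:E\to[0,\infty)$, and a probability kernel $Q(\cdot,x)$ on $E$, $x\in\bigcup_k\{k\}\times(E_k\cup\partial^+_{\phi_k}E_k)$,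 with $Q(\{x\},x)=0$ for $x\in E$. For $x=(k,y)\in E$ let $t^*(x)=\inf\{t>0:\phi_k(y,t)\in\partial^+_{\phi_k}E_k\}$ (with $\inf\emptyset=\infty$) and $$S(x,t)=\exp\Big(-\int_0^t\lambda_k(\phi_k(y,u))\,du\Big)\ \text{ if } t<t^*(x),\qquad S(x,t)=0\ \text{ if } t\ge t^*(x).$$ A *piecewise deterministic Markov process (PDMP)* with these characteristics, starting in $x\in E$, is an $E$-valued process $(X_t)_{t\ge0}$ with $X_0=x$ a.s. for which there are random times $0=T_0\le T_1\le T_2\le\dots$ in $[0,\infty]$, $T_n\to\infty$ a.s., such that 1. a.s., for all $n$ and all $t\in[T_n,T_{n+1})$: if $X_{T_n}=(k,y)$, then $X_t=(k,\phi_k(y,t-T_n))$; 2. for all $n$ and all $s,t\ge0$: $\mathbb P(T_{n+1}-s>t\mid X_s,\ T_n\le s<T_{n+1})=S(X_s,t)$; 3. for all $n$, on $\{T_{n+1}<\infty\}$ the left limit $X_{T_{n+1}-}$ exists in $\bigcup_k\{k\}\times(E_k\cup\partial^+_{\phi_k}E_k)$, and $\mathbb P(X_{T_{n+1}}\in A\mid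 X_{T_{n+1}-},\,T_{n+1}<\infty)=Q(A,X_{T_{n+1}-})$ for every measurable $A\subseteq E$. For $K^c\subseteq K$, the set $E^c=\bigcup_{k\in K^c}\{k\}\times E_k$ is a *cemetery* of the PDMP if $\lambda_k\equiv0$ and $\phi_k(y,t)=y$ for all $k\in K^c$, $y\in E_k$, $t\in\mathbb R$. A *running reward function* is a measurable $\ell:E\to\mathbb R$ with $\ell=0$ on $E^c$; a *terminal cost function* is a measurable $\Psi:E\to\mathbb R$ with $\Psi=0$ on $E\setminus E^c$. **Lemma.** Let $X$ and $X^n$, $n\in\mathbb N$, be PDMPs (possibly on different probability spaces and with different local characteristics) on the same state space $E$, with the same cemetery $E^c$ and the same starting point $x\in E$, all with paths in the space $D([0,\infty),E)$ of càdlàg functions equipped with the Skorokhod ($J_1$) topology, and suppose $X^n\to X$ in distribution in $D([0,\infty),E)$. Let $\delta>0$, and let $\ell$ and $\Psi$ be a running reward function and a terminal cost function that are continuous and bounded. For $Y=X$ or $Y=X^n$ let $\tau=\inf\{t\ge0: Y_t\in E^c\}\in[0,\infty]$, the term $e^{-\delta\tau}\Psi(Y_\tau)$ being $0$ if $\tau=\infty$.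 Then the random variables $\int_0^\tau e^{-\delta t}\ell(Y_t)\,dt+e^{-\delta\tau}\Psi(Y_\tau)$ are integrable and $$\mathbb E_x\Big(\int_0^\tau e^{-\delta t}\ell(X^n_t)\,dt+e^{-\delta\tau}\Psi(X^n_\tau)\Big)\longrightarrow\mathbb E_x\Big(\int_0^\tau e^{-\delta t}\ell(X_t)\,dt+e^{-\delta\tau}\Psi(X_\tau)\Big)\qquad(n\to\infty).$$ -/

import Mathlib

open MeasureTheory ProbabilityTheory Filter Set
open scoped Topology NNReal ENNReal

noncomputable section

namespace PDMP

/-! ### The space of càdlàg paths with the Skorokhod topology -/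

/-- A path is càdlàg: right continuous, with left limits (in the space itself). -/
def IsCadlag {E : Type*} [TopologicalSpace E] (x : ℝ≥0 → E) : Prop :=
  ∀ t, ContinuousWithinAt x (Ici t) t ∧ ∃ l, Tendsto x (𝓝[<] t) (𝓝 l)

/-- The space `D([0,∞), E)` of càdlàg paths. -/
structure CadlagPath (E : Type*) [TopologicalSpace E] where
  toFun : ℝ≥0 → E
  isCadlag : IsCadlag toFun

instance {E : Type*} [TopologicalSpace E] : CoeFun (CadlagPath E) (fun _ => ℝ≥0 → E) :=
  ⟨CadlagPath.toFun⟩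

namespace CadlagPath

/-- The paths `y` which, after a change of time (a strictly increasing bijection `σ` of `[0,∞)`)
that moves the times of `[0,T]` by less than `ε`, are `ε`-close to `x` on `[0,T]`. -/
def skorokhodNhd {E : Type*} [MetricSpace E] (x : CadlagPath E) (T : ℝ≥0) (ε : ℝ) :
    Set (CadlagPath E) :=
  {y | ∃ σ : ℝ≥0 ≃o ℝ≥0, ∀ t ≤ T, dist (σ t) t < ε ∧ dist (y t) (x (σ t)) < ε}

theorem skorokhodNhd_mono {E : Type*} [MetricSpace E] (x : CadlagPath E) {T T' : ℝ≥0} {ε ε' : ℝ}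
    (hT : T ≤ T') (hε : ε' ≤ ε) : skorokhodNhd x T' ε' ⊆ skorokhodNhd x T ε := by
  rintro y ⟨σ, h⟩
  exact ⟨σ, fun t ht => ⟨(h t (ht.trans hT)).1.trans_le hε, (h t (ht.trans hT)).2.trans_le hε⟩⟩

/-- The Skorokhod (J1) topology on `D([0,∞), E)`: a sequence `xₙ` converges to `x` iff for every
`T` there are time changes `σₙ` with `sup_{t ≤ T} |σₙ t - t| → 0` and
`sup_{t ≤ T} dist (xₙ t) (x (σₙ t)) → 0`. -/
instance skorokhodTopology {E : Type*} [MetricSpace E] : TopologicalSpace (CadlagPath E) where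
  IsOpen U := ∀ x ∈ U, ∃ T : ℝ≥0, ∃ ε : ℝ, 0 < ε ∧ skorokhodNhd x T ε ⊆ U
  isOpen_univ := fun _ _ => ⟨0, 1, one_pos, subset_univ _⟩
  isOpen_inter := by
    rintro U V hU hV x ⟨hxU, hxV⟩
    obtain ⟨T, ε, hε, h⟩ := hU x hxU
    obtain ⟨T', ε', hε', h'⟩ := hV x hxV
    refine ⟨max T T', min ε ε', lt_min hε hε', subset_inter ?_ ?_⟩
    · exact (skorokhodNhd_mono x (le_max_left _ _) (min_le_left _ _)).trans h
    · exact (skorokhodNhd_mono x (le_max_right _ _) (min_le_right _ _)).trans h'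
  isOpen_sUnion := by
    rintro 𝒰 h𝒰 x ⟨U, hU, hxU⟩
    obtain ⟨T, ε, hε, h⟩ := h𝒰 U hU x hxU
    exact ⟨T, ε, hε, h.trans (subset_sUnion_of_mem hU)⟩

instance {E : Type*} [MetricSpace E] : MeasurableSpace (CadlagPath E) := borel _

instance {E : Type*} [MetricSpace E] : BorelSpace (CadlagPath E) := ⟨rfl⟩

end CadlagPath

/-! ### Flows and boundaries -/

/-- A (local) flow on a set `A ⊆ ℝᵈ`. -/
structure IsFlow {d : ℕ} (A : Set (EuclideanSpace ℝ (Fin d)))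
    (φ : A → ℝ → EuclideanSpace ℝ (Fin d)) : Prop where
  continuous : Continuous (fun p : A × ℝ => φ p.1 p.2)
  map_zero : ∀ x : A, φ x 0 = x
  map_add : ∀ (x : A) (s t : ℝ) (ht : φ x t ∈ A),
    φ ⟨φ x t, ht⟩ s ∈ A → φ x (t + s) = φ ⟨φ x t, ht⟩ s

/-- The points of the boundary of `A` that are reached by a trajectory from the interior of `A`
without passing other boundary points in between. As `φ` is defined on `A` only, the trajectory
`s ↦ φ(x,-s)` is followed from an interior point `y = φ(x,-t)`. -/
def exitBoundary {d : ℕ} (A : Set (EuclideanSpace ℝ (Fin d)))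
    (φ : A → ℝ → EuclideanSpace ℝ (Fin d)) : Set (EuclideanSpace ℝ (Fin d)) :=
  {x | x ∈ frontier A ∧
    ∃ (y : A) (t : ℝ), 0 < t ∧ φ y t = x ∧ ∀ s ∈ Ico 0 t, φ y s ∈ interior A}

/-- The points of the boundary of `A` from which a trajectory moves into the interior of `A`
immediately (again followed from an interior point `y = φ(x,t)`). -/
def entranceBoundary {d : ℕ} (A : Set (EuclideanSpace ℝ (Fin d)))
    (φ : A → ℝ → EuclideanSpace ℝ (Fin d)) : Set (EuclideanSpace ℝ (Fin d)) :=
  {x | x ∈ frontier A ∧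
    ∃ (y : A) (t : ℝ), 0 < t ∧ φ y (-t) = x ∧ ∀ s ∈ Ico 0 t, φ y (-s) ∈ interior A}

/-! ### State space -/

/-- The state space `E = ⋃ₖ {k} × Eₖ`. -/
def StateSpace {K : Type*} {d : K → ℕ} (S : ∀ k, Set (EuclideanSpace ℝ (Fin (d k)))) : Type _ :=
  Σ k, S k

/-- The σ-algebra generated by the sets `{k} × B` with `B ⊆ Eₖ` Borel. -/
instance {K : Type*} {d : K → ℕ} (S : ∀ k, Set (EuclideanSpace ℝ (Fin (d k)))) :
    MeasurableSpace (StateSpace S) :=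
  inferInstanceAs (MeasurableSpace (Σ k, S k))

/-- A metric for the disjoint union topology: points in different components have distance at
least one, and on each `{k} × Eₖ` it is the Euclidean metric. -/
instance {K : Type*} {d : K → ℕ} (S : ∀ k, Set (EuclideanSpace ℝ (Fin (d k)))) :
    MetricSpace (StateSpace S) :=
  Metric.Sigma.metricSpace (E := fun k => S k)

/-- The disjoint union of the ambient Euclidean spaces. -/
abbrev Ambient {K : Type*} (d : K → ℕ) : Type _ := Σ k, EuclideanSpace ℝ (Fin (d k))

/-! ### Local characteristics -/

/-- Local characteristics `(φ, λ, Q)` of a PDMP with state space `E = ⋃ₖ {k} × Eₖ`. -/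
structure LocalCharacteristics {K : Type*} {d : K → ℕ}
    (S : ∀ k, Set (EuclideanSpace ℝ (Fin (d k)))) where
  /-- the flow `φₖ` on each component -/
  flow : ∀ k, S k → ℝ → EuclideanSpace ℝ (Fin (d k))
  isFlow : ∀ k, IsFlow (S k) (flow k)
  component_eq : ∀ k, S k = interior (S k) ∪
    (entranceBoundary (S k) (flow k) \ exitBoundary (S k) (flow k))
  /-- the jump intensity `λ` -/
  rate : StateSpace S → ℝ≥0
  measurable_rate : Measurable rate
  bounded_rate : ∃ C, ∀ x, rate x ≤ C
  /-- the jump kernel `Q`, from `E` together with the active boundary to `E` -/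
  jump : Kernel (Σ k, ↥(S k ∪ exitBoundary (S k) (flow k))) (StateSpace S)
  isMarkovKernel_jump : IsMarkovKernel jump
  jump_self : ∀ (k : K) (y : S k), jump ⟨k, ⟨y, Or.inl y.2⟩⟩ {⟨k, y⟩} = 0

namespace LocalCharacteristics

variable {K : Type*} {d : K → ℕ} {S : ∀ k, Set (EuclideanSpace ℝ (Fin (d k)))}

/-- `t*(x)`: the time at which the flow started in `x` reaches the active boundary, `∞` if it
does not. -/
def exitTime (D : LocalCharacteristics S) (x : StateSpace S) : ℝ≥0∞ :=
  ⨅ (t : ℝ≥0) (_ : 0 < t ∧ D.flow x.1 x.2 t ∈ exitBoundary (S x.1) (D.flow x.1)), (t : ℝ≥0∞)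

open Classical in
/-- `λₖ(φₖ(y,u))` for `x = (k,y)`. The flow stays in `Eₖ` for `0 ≤ u < t*(x)`; only these `u` are
used. -/
def rateAlong (D : LocalCharacteristics S) (x : StateSpace S) (u : ℝ) : ℝ :=
  if h : D.flow x.1 x.2 u ∈ S x.1 then D.rate ⟨x.1, ⟨D.flow x.1 x.2 u, h⟩⟩ else 0

open Classical in
/-- The probability that a process in state `x` does not jump during a time `t`:
`exp(-∫₀ᵗ λ(φ(x,u)) du)` for `t < t*(x)`, and `0` for `t ≥ t*(x)`. -/
def survival (D : LocalCharacteristics S) (x : StateSpace S) (t : ℝ≥0) : ℝ≥0∞ :=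
  if (t : ℝ≥0∞) < D.exitTime x then
    ENNReal.ofReal (Real.exp (-∫ u in (0 : ℝ)..t, D.rateAlong x u)) else 0

/-- `X` is a piecewise deterministic Markov process with local characteristics `D`, starting in
`x`. There are jump times `0 = T 0 ≤ T 1 ≤ …` tending to `∞`, and pre-jump locations
`Z n = X_{T (n+1)-}` (left limits, which may lie on the active boundary), such that

* between jumps the process follows the flow;
* given `X s` and `T n ≤ s < T (n+1)`, the time `T (n+1) - s` to the next jump has the survival
  function `D.survival (X s)`;
* given `T (n+1) < ∞` and `Z n`, the new location has the law `Q(·, Z n)`.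

The two conditional laws are written in integrated form. -/
def IsPDMP (D : LocalCharacteristics S) (x : StateSpace S) {Ω : Type*} [MeasurableSpace Ω]
    (μ : Measure Ω) (X : ℝ≥0 → Ω → StateSpace S) : Prop :=
  (∀ t, Measurable (X t)) ∧
  (∀ᵐ ω ∂μ, X 0 ω = x) ∧
  ∃ (T : ℕ → Ω → ℝ≥0∞) (Z : ℕ → Ω → Σ k, ↥(S k ∪ exitBoundary (S k) (D.flow k))),
    (∀ n, Measurable (T n)) ∧ (∀ n, Measurable (Z n)) ∧
    (∀ᵐ ω ∂μ, T 0 ω = 0 ∧ (∀ n, T n ω ≤ T (n + 1) ω) ∧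
      Tendsto (fun n => T n ω) atTop (𝓝 ⊤)) ∧
    (∀ᵐ ω ∂μ, ∀ (n : ℕ) (t : ℝ≥0), T n ω ≤ t → t < T (n + 1) ω →
      (⟨(X t ω).1, (X t ω).2⟩ : Ambient d) =
        ⟨(X (T n ω).toNNReal ω).1,
          D.flow _ (X (T n ω).toNNReal ω).2 (t - (T n ω).toReal)⟩) ∧
    (∀ᵐ ω ∂μ, ∀ n, T (n + 1) ω ≠ ⊤ →
      Tendsto (fun s : ℝ≥0 => (⟨(X s ω).1, (X s ω).2⟩ : Ambient d))
        (𝓝[<] (T (n + 1) ω).toNNReal) (𝓝 ⟨(Z n ω).1, (Z n ω).2⟩)) ∧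
    (∀ (n : ℕ) (s t : ℝ≥0) (B : Set (StateSpace S)), MeasurableSet B →
      μ {ω | X s ω ∈ B ∧ T n ω ≤ s ∧ (s : ℝ≥0∞) + t < T (n + 1) ω} =
        ∫⁻ ω in {ω | X s ω ∈ B ∧ T n ω ≤ s ∧ (s : ℝ≥0∞) < T (n + 1) ω},
          D.survival (X s ω) t ∂μ) ∧
    (∀ (n : ℕ) (B : Set (Σ k, ↥(S k ∪ exitBoundary (S k) (D.flow k)))) (A : Set (StateSpace S)),
      MeasurableSet B → MeasurableSet A →
      μ {ω | T (n + 1) ω ≠ ⊤ ∧ Z n ω ∈ B ∧ X (T (n + 1) ω).toNNReal ω ∈ A} =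
        ∫⁻ ω in {ω | T (n + 1) ω ≠ ⊤ ∧ Z n ω ∈ B}, D.jump (Z n ω) A ∂μ)

/-- `⋃_{k ∈ Kc} Eₖ` is a cemetery: there, the jump intensity vanishes and the flow is constant. -/
def IsCemetery (D : LocalCharacteristics S) (Kc : Set K) : Prop :=
  ∀ k ∈ Kc, ∀ y : S k, D.rate ⟨k, y⟩ = 0 ∧ ∀ t, D.flow k y t = y

end LocalCharacteristics

/-! ### Cost functionals -/

variable {K : Type*} {d : K → ℕ}

/-- The set `Eᶜ = ⋃_{k ∈ Kc} {k} × Eₖ`. -/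
def cemetery (S : ∀ k, Set (EuclideanSpace ℝ (Fin (d k)))) (Kc : Set K) : Set (StateSpace S) :=
  {x | x.1 ∈ Kc}

variable {S : ∀ k, Set (EuclideanSpace ℝ (Fin (d k)))}

/-- A running reward function: measurable, and zero on the cemetery. -/
def IsRunningReward (Kc : Set K) (ℓ : StateSpace S → ℝ) : Prop :=
  Measurable ℓ ∧ ∀ x ∈ cemetery S Kc, ℓ x = 0

/-- A terminal cost function: measurable, and zero off the cemetery. -/
def IsTerminalCost (Kc : Set K) (Ψ : StateSpace S → ℝ) : Prop :=
  Measurable Ψ ∧ ∀ x ∉ cemetery S Kc, Ψ x = 0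

/-- `τ = inf {t ≥ 0 : xₜ ∈ Eᶜ}`, with `inf ∅ = ∞`. -/
def hittingTime (Kc : Set K) (x : ℝ≥0 → StateSpace S) : ℝ≥0∞ :=
  ⨅ (t : ℝ≥0) (_ : x t ∈ cemetery S Kc), (t : ℝ≥0∞)

open Classical in
/-- `∫₀^τ e^{-δt} ℓ(xₜ) dt + e^{-δτ} Ψ(x_τ)`, the second term being zero if `τ = ∞`. -/
def pathCost (Kc : Set K) (δ : ℝ) (ℓ Ψ : StateSpace S → ℝ) (x : ℝ≥0 → StateSpace S) : ℝ :=
  (∫ t in {t : ℝ | 0 ≤ t ∧ ENNReal.ofReal t < hittingTime Kc x},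
      Real.exp (-δ * t) * ℓ (x t.toNNReal)) +
    if hittingTime Kc x = ⊤ then 0
    else Real.exp (-δ * (hittingTime Kc x).toReal) * Ψ (x (hittingTime Kc x).toNNReal)

end PDMP

end

namespace PDMP

/-! ### Discounted integrals along càdlàg paths -/

/-! The cost involves `hittingTime` and the value there, for which Skorokhod continuity is not
evident. The remedy is absorption: a path is almost surely frozen once in the cemetery
(`IsPDMP.ae_absorbed`), so $e^{-\delta\tau}\Psi(X_\tau)=\int_\tau^\infty \delta e^{-\delta
t}\Psi(X_t)\,dt$. As $\ell$ vanishes on the cemetery and $\Psi$ off it, the whole cost is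
$\int_0^\infty e^{-\delta t}(\ell+\delta\Psi)(X_t)\,dt$ (`pathCost_eq_discountedIntegral`). This
functional is bounded and continuous on path space (`continuous_discountedIntegral`): Skorokhod
convergence implies convergence at continuity times of the limit, hence at almost every time, and
$e^{-\delta t}$ gives domination. Convergence in distribution then yields the claim. -/

theorem IsCadlag.countable_not_continuousAt {E : Type*} [MetricSpace E] {x : ℝ≥0 → E}
    (hx : IsCadlag x) : {t | ¬ ContinuousAt x t}.Countable := by
  choose L hL using fun t => (hx t).2
  -- Jumps larger than `ε` are isolated from the right: just after `t` the path, hence also its left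
  -- limits, stay within `ε / 2` of `x t`.
  have key : ∀ ε : ℝ, 0 < ε → {t | ε < dist (L t) (x t)}.Countable := by
    intro ε hε
    refine Countable.mono (fun t ht => ?_) (countable_setOfPred_isolated_right_within
      (s := {t | ε < dist (L t) (x t)}))
    refine mem_sep ht ?_
    have h1 : ∀ᶠ s in 𝓝[>] t, dist (x s) (x t) < ε / 2 :=
      (((hx t).1.mono Ioi_subset_Ici_self).tendsto.eventually
        (Metric.ball_mem_nhds (x t) (half_pos hε)))
    have h2 : ∀ᶠ s in 𝓝[>] t, s ∉ {t | ε < dist (L t) (x t)} := by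
      filter_upwards [eventually_eventually_nhdsWithin.2 h1, h1, self_mem_nhdsWithin]
        with s hs hs' hts
      rw [isOpen_Ioi.nhdsWithin_eq hts] at hs
      have : (𝓝[<] s).NeBot := nhdsLT_neBot_of_exists_lt ⟨t, hts⟩
      have h3 : dist (L s) (x t) ≤ ε / 2 :=
        le_of_tendsto ((hL s).dist tendsto_const_nhds)
          ((hs.filter_mono nhdsWithin_le_nhds).mono fun _ h => h.le)
      have h4 := dist_triangle_right (L s) (x s) (x t)
      simp only [not_lt]
      linarith
    rw [inter_comm, nhdsWithin_inter', inf_principal_eq_bot]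
    exact h2
  refine (countable_iUnion fun n : ℕ =>
    key (1 / ((n : ℝ) + 1)) (by positivity)).mono fun t ht => ?_
  have hne : L t ≠ x t := by
    intro h
    refine ht (continuousAt_iff_continuous_left'_right'.2
      ⟨?_, (hx t).1.mono Ioi_subset_Ici_self⟩)
    have := hL t
    rwa [h] at this
  obtain ⟨n, hn⟩ := exists_nat_one_div_lt (dist_pos.2 hne)
  exact mem_iUnion.2 ⟨n, hn⟩

theorem CadlagPath.ae_continuousAt {E : Type*} [MetricSpace E] (x : CadlagPath E) :
    ∀ᵐ t : ℝ ∂volume.restrict (Ioi 0), ContinuousAt x t.toNNReal := by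
  rw [ae_restrict_iff' measurableSet_Ioi]
  refine measure_mono_null (t := (fun s : ℝ≥0 => (s : ℝ)) '' {t | ¬ ContinuousAt x t}) ?_
    ((x.isCadlag.countable_not_continuousAt.image _).measure_zero _)
  intro t ht
  simp only [mem_compl_iff, mem_ofPred_eq, Classical.not_imp] at ht
  exact ⟨t.toNNReal, ht.2, Real.coe_toNNReal t (le_of_lt ht.1)⟩

theorem CadlagPath.aestronglyMeasurable_comp {E : Type*} [MetricSpace E] (x : CadlagPath E)
    {g : E → ℝ} (hg : Continuous g) :
    AEStronglyMeasurable (fun t : ℝ => g (x t.toNNReal)) (volume.restrict (Ioi 0)) := by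
  set C : Set ℝ := Real.toNNReal ⁻¹' {t | ¬ ContinuousAt x t} ∩ Ioi 0 with hC
  have hCc : C.Countable :=
    Countable.mono (fun t ht => (mem_image _ _ _).2
      ⟨t.toNNReal, ht.1, Real.coe_toNNReal t (le_of_lt ht.2)⟩)
      (x.isCadlag.countable_not_continuousAt.image (fun s : ℝ≥0 => (s : ℝ)))
  have h1 : AEStronglyMeasurable (fun t : ℝ => g (x t.toNNReal))
      (volume.restrict (Ioi 0 \ C)) := by
    refine ContinuousOn.aestronglyMeasurable (fun t ht => ?_)
      (measurableSet_Ioi.diff hCc.measurableSet)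
    have : ContinuousAt x t.toNNReal := by
      by_contra h
      exact ht.2 ⟨h, ht.1⟩
    exact (hg.continuousAt.comp
      (this.comp (f := Real.toNNReal) continuous_real_toNNReal.continuousAt)).continuousWithinAt
  rwa [Measure.restrict_congr_set (sdiff_null_ae_eq_self (hCc.measure_zero _))] at h1

/-- The discounted integral `∫₀^∞ e^{-δt} g(xₜ) dt` along a path. -/
noncomputable def discountedIntegral {E : Type*} [MetricSpace E] (δ : ℝ) (g : E → ℝ)
    (x : CadlagPath E) : ℝ :=
  ∫ t in Ioi (0 : ℝ), Real.exp (-δ * t) * g (x t.toNNReal)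

theorem norm_exp_mul_le {E : Type*} {δ : ℝ} {g : E → ℝ} {C : ℝ} (hC : ∀ z, |g z| ≤ C)
    (t : ℝ) (z : E) :
    ‖Real.exp (-δ * t) * g z‖ ≤ Real.exp (-δ * t) * C := by
  rw [norm_mul, Real.norm_eq_abs, Real.norm_eq_abs, Real.abs_exp]
  exact mul_le_mul_of_nonneg_left (hC z) (Real.exp_pos _).le

section DiscountedIntegral

variable {E : Type*} [MetricSpace E] {δ : ℝ} {g : E → ℝ} {C : ℝ}

theorem aestronglyMeasurable_exp_mul (hg : Continuous g) (x : CadlagPath E) :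
    AEStronglyMeasurable (fun t : ℝ => Real.exp (-δ * t) * g (x t.toNNReal))
      (volume.restrict (Ioi 0)) :=
  (by fun_prop : Continuous fun t : ℝ => Real.exp (-δ * t)).aestronglyMeasurable.mul
    (x.aestronglyMeasurable_comp hg)

theorem integrableOn_exp_mul (hδ : 0 < δ) (hg : Continuous g) (hC : ∀ z, |g z| ≤ C)
    (x : CadlagPath E) :
    IntegrableOn (fun t : ℝ => Real.exp (-δ * t) * g (x t.toNNReal)) (Ioi 0) :=
  ((exp_neg_integrableOn_Ioi 0 hδ).mul_const C).mono' (aestronglyMeasurable_exp_mul hg x)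
    (Eventually.of_forall fun t => norm_exp_mul_le hC t _)

theorem abs_discountedIntegral_le (hδ : 0 < δ) (hC : ∀ z, |g z| ≤ C) (x : CadlagPath E) :
    |discountedIntegral δ g x| ≤ ∫ t in Ioi (0 : ℝ), Real.exp (-δ * t) * C :=
  norm_integral_le_of_norm_le ((exp_neg_integrableOn_Ioi 0 hδ).mul_const C)
    (Eventually.of_forall fun t => norm_exp_mul_le hC t _)

/-- At a continuity time `s` of `x`, `y n s` is close to `x (σ n s)`, and `σ n s → s`. -/
theorem tendsto_discountedIntegral (hδ : 0 < δ) (hg : Continuous g) (hC : ∀ z, |g z| ≤ C)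
    {x : CadlagPath E} {y : ℕ → CadlagPath E}
    (hy : ∀ n : ℕ, y n ∈ x.skorokhodNhd n (1 / ((n : ℝ) + 1))) :
    Tendsto (fun n => discountedIntegral δ g (y n)) atTop (𝓝 (discountedIntegral δ g x)) := by
  choose σ hσ using hy
  refine tendsto_integral_of_dominated_convergence (fun t => Real.exp (-δ * t) * C)
    (fun n => aestronglyMeasurable_exp_mul hg _) ((exp_neg_integrableOn_Ioi 0 hδ).mul_const C)
    (fun n => Eventually.of_forall fun t => norm_exp_mul_le hC t _) ?_
  filter_upwards [x.ae_continuousAt] with t ht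
  refine Tendsto.const_mul _ ((hg.tendsto _).comp ?_)
  set s := t.toNNReal
  -- The `n`-th neighbourhood controls times up to `n` only.
  have hs : ∀ᶠ n : ℕ in atTop, s ≤ n := tendsto_natCast_atTop_atTop.eventually_ge_atTop s
  have h0 : Tendsto (fun n : ℕ => 1 / ((n : ℝ) + 1)) atTop (𝓝 0) :=
    tendsto_one_div_add_atTop_nhds_zero_nat
  have hσt : Tendsto (fun n => σ n s) atTop (𝓝 s) := by
    rw [tendsto_iff_dist_tendsto_zero]
    exact squeeze_zero' (Eventually.of_forall fun _ => dist_nonneg)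
      (hs.mono fun n hn => (hσ n s hn).1.le) h0
  refine (tendsto_iff_of_dist ?_).2 (ht.tendsto.comp hσt)
  exact squeeze_zero' (Eventually.of_forall fun _ => dist_nonneg)
    (hs.mono fun n hn => (hσ n s hn).2.le) h0

/-- Openness is defined through `skorokhodNhd`, so failure at `x` produces a sequence to which
`tendsto_discountedIntegral` applies. -/
theorem continuous_discountedIntegral (hδ : 0 < δ) (hg : Continuous g) (hC : ∀ z, |g z| ≤ C) :
    Continuous (discountedIntegral δ g) := by
  refine continuous_def.2 fun V hV x hx => ?_
  by_contra! h
  have h' : ∀ n : ℕ, ∃ y ∈ x.skorokhodNhd n (1 / ((n : ℝ) + 1)),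
      y ∉ discountedIntegral δ g ⁻¹' V :=
    fun n => not_subset.1 (h n _ (by positivity))
  choose y hy hyV using h'
  obtain ⟨n, hn⟩ := ((tendsto_discountedIntegral hδ hg hC hy).eventually (hV.mem_nhds hx)).exists
  exact hyV n hn

end DiscountedIntegral

/-! ### Costs of absorbed paths -/

variable {K : Type*} {d : K → ℕ} {S : ∀ k, Set (EuclideanSpace ℝ (Fin (d k)))}

theorem fst_eq_of_dist_lt_one {x y : StateSpace S} (h : dist x y < 1) : x.1 = y.1 :=
  Metric.Sigma.fst_eq_of_dist_lt_one (E := fun k => S k) x y h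

theorem measurableSet_cemetery (Kc : Set K) : MeasurableSet (cemetery S Kc) := by
  have : ∀ k : K, MeasurableSet ((fun y => ⟨k, y⟩ : S k → StateSpace S) ⁻¹' cemetery S Kc) :=
    fun k => MeasurableSet.const (k ∈ Kc)
  -- Measurability is tested on each component, where the preimage is everything or empty.
  exact MeasurableSpace.measurableSet_iInf.2 this

/-- Different components are at distance at least one, so right continuity keeps the path in one
component on some `[r, u)`. Were `x r` outside the cemetery, no hit could occur before `u > r`. -/
theorem apply_hittingTime_mem_cemetery {Kc : Set K} (x : CadlagPath (StateSpace S))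
    (h : hittingTime Kc x ≠ ⊤) : x (hittingTime Kc x).toNNReal ∈ cemetery S Kc := by
  set r := (hittingTime Kc x).toNNReal with hr
  have hr' : (r : ℝ≥0∞) = hittingTime Kc x := ENNReal.coe_toNNReal h
  have hle : ∀ t, x t ∈ cemetery S Kc → r ≤ t := fun t ht =>
    ENNReal.coe_le_coe.1 (hr' ▸ iInf₂_le t ht)
  have hev : ∀ᶠ t in 𝓝[≥] r, (x t).1 = (x r).1 :=
    ((x.isCadlag r).1.tendsto.eventually (Metric.ball_mem_nhds _ one_pos)).mono
      fun t ht => fst_eq_of_dist_lt_one ht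
  obtain ⟨u, hu, hru⟩ := (mem_nhdsGE_iff_exists_Ico_subset.1 hev)
  by_contra hx
  have : (u : ℝ≥0∞) ≤ r := by
    rw [hr']
    refine le_iInf₂ fun t ht => ENNReal.coe_le_coe.2 (not_lt.1 fun htu => hx ?_)
    have := hru ⟨hle t ht, htu⟩
    change (x r).1 ∈ Kc
    rw [← this]
    exact ht
  exact absurd (ENNReal.coe_le_coe.1 this) (not_le.2 hu)

/-- Along a path that stops when it enters the cemetery, the terminal cost is a running reward:
`e^{-δτ} Ψ(x_τ) = ∫_τ^∞ e^{-δt} δ Ψ(xₜ) dt`. -/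
theorem pathCost_eq_discountedIntegral {Kc : Set K} {δ : ℝ} (hδ : 0 < δ)
    {ℓ Ψ : StateSpace S → ℝ} (hℓ : ∀ z ∈ cemetery S Kc, ℓ z = 0)
    (hΨ : ∀ z ∉ cemetery S Kc, Ψ z = 0) {C : ℝ} (hg : Continuous fun z => ℓ z + δ * Ψ z)
    (hC : ∀ z, |ℓ z + δ * Ψ z| ≤ C) (x : CadlagPath (StateSpace S))
    (hx : ∀ t u, t ≤ u → x t ∈ cemetery S Kc → x u = x t) :
    pathCost Kc δ ℓ Ψ x = discountedIntegral δ (fun z => ℓ z + δ * Ψ z) x := by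
  have hlt : ∀ t : ℝ≥0, (t : ℝ≥0∞) < hittingTime Kc x → x t ∉ cemetery S Kc := fun t ht hmem =>
    (iInf₂_le t hmem : hittingTime Kc x ≤ t).not_gt ht
  unfold pathCost discountedIntegral
  by_cases h : hittingTime Kc x = ⊤
  · have hset : {t : ℝ | 0 ≤ t ∧ ENNReal.ofReal t < hittingTime Kc x} = Ici 0 := by
      ext t
      simp [h]
    rw [if_pos h, add_zero, hset, integral_Ici_eq_integral_Ioi]
    refine setIntegral_congr_fun measurableSet_Ioi fun t _ => ?_
    simp [hΨ _ (hlt t.toNNReal (h ▸ ENNReal.coe_lt_top))]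
  · have hmem := apply_hittingTime_mem_cemetery x h
    set r := (hittingTime Kc x).toNNReal with hr
    have hr' : hittingTime Kc x = r := (ENNReal.coe_toNNReal h).symm
    have hset : {t : ℝ | 0 ≤ t ∧ ENNReal.ofReal t < hittingTime Kc x} = Ico 0 (r : ℝ) := by
      ext t
      simp only [mem_ofPred_eq, mem_Ico, and_congr_right_iff, hr', ENNReal.ofReal]
      intro ht
      rw [ENNReal.coe_lt_coe, Real.toNNReal_lt_iff_lt_coe ht]
    have hI := integrableOn_exp_mul hδ hg hC x
    rw [if_neg h, hset, ← integral_Ici_eq_integral_Ioi, ← Ico_union_Ici_eq_Ici r.coe_nonneg,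
      setIntegral_union ((Iio_disjoint_Ici le_rfl).mono_left Ico_subset_Iio_self)
        measurableSet_Ici
        (((integrableOn_Ici_iff_integrableOn_Ioi).2 hI).mono_set Ico_subset_Ici_self)
        (((integrableOn_Ici_iff_integrableOn_Ioi).2 hI).mono_set
          (Ici_subset_Ici.2 r.coe_nonneg))]
    congr 1
    · refine setIntegral_congr_fun measurableSet_Ico fun t ht => ?_
      have : x t.toNNReal ∉ cemetery S Kc := hlt _ <| by
        rw [hr', ENNReal.coe_lt_coe, Real.toNNReal_lt_iff_lt_coe ht.1]
        exact ht.2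
      simp [hΨ _ this]
    -- From `r` on the path is frozen at `x r`, where `ℓ` vanishes; `∫_r^∞ δ e^{-δt} dt = e^{-δr}`.
    · have h1 : ∀ t ∈ Ici (r : ℝ), Real.exp (-δ * t) * (ℓ (x t.toNNReal) + δ * Ψ (x t.toNNReal)) =
          Real.exp (-δ * t) * (δ * Ψ (x r)) := fun t ht => by
        rw [hx r t.toNNReal (NNReal.le_toNNReal_of_coe_le ht) hmem, hℓ _ hmem, zero_add]
      rw [setIntegral_congr_fun measurableSet_Ici h1, integral_mul_const,
        integral_Ici_eq_integral_Ioi, integral_exp_mul_Ioi (neg_neg_of_pos hδ), hr',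
        ENNReal.coe_toReal]
      field_simp

/-! ### Absorption in the cemetery -/

namespace LocalCharacteristics

theorem IsCemetery.survival_eq_one {D : LocalCharacteristics S} {Kc : Set K}
    (hD : D.IsCemetery Kc) {x : StateSpace S} (hx : x ∈ cemetery S Kc) (t : ℝ≥0) :
    D.survival x t = 1 := by
  obtain ⟨k, y⟩ := x
  have hk : k ∈ Kc := hx
  have hexit : D.exitTime ⟨k, y⟩ = ⊤ := by
    refine iInf₂_eq_top.2 fun t ht => absurd ht.2 ?_
    -- The flow fixes `z`, so the exit point would be `z` itself, in both frontier and interior.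
    rintro ⟨hfr, z, s, hs, hzs, hz⟩
    have h0 := hz 0 ⟨le_rfl, hs⟩
    rw [(hD k hk z).2] at h0 hzs
    rw [← hzs] at hfr
    exact hfr.2 h0
  have hrate : ∀ u, D.rateAlong ⟨k, y⟩ u = 0 := by
    intro u
    unfold rateAlong
    split_ifs with h
    · exact congrArg NNReal.toReal (hD k hk _).1
    · rfl
  simp [survival, hexit, hrate]

/-- In the cemetery the survival function is one, so no further jump occurs. The exceptional null
set depends on the observation time; rational times suffice, since every interval between jumps that
contains `t` also contains a rational time after `t`, and the flow is constant there. -/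
theorem IsPDMP.ae_absorbed {D : LocalCharacteristics S} {Kc : Set K} (hD : D.IsCemetery Kc)
    {x : StateSpace S} {Ω : Type*} [MeasurableSpace Ω] {μ : Measure Ω} [IsFiniteMeasure μ]
    {X : ℝ≥0 → Ω → StateSpace S} (hX : D.IsPDMP x μ X) :
    ∀ᵐ ω ∂μ, ∀ t u, t ≤ u → X t ω ∈ cemetery S Kc → X u ω = X t ω := by
  obtain ⟨hXm, -, T, Z, hT, -, hT0, hflow, -, hjump, -⟩ := hX
  have hlast : ∀ᵐ ω ∂μ, ∀ (n : ℕ) (q : ℚ), X (q : ℝ).toNNReal ω ∈ cemetery S Kc →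
      T n ω ≤ (q : ℝ).toNNReal → ((q : ℝ).toNNReal : ℝ≥0∞) < T (n + 1) ω → T (n + 1) ω = ⊤ := by
    refine ae_all_iff.2 fun n => ae_all_iff.2 fun q => ?_
    generalize (q : ℝ).toNNReal = s
    have hstep : ∀ᵐ ω ∂μ, ∀ m : ℕ, X s ω ∈ cemetery S Kc → T n ω ≤ s →
        (s : ℝ≥0∞) < T (n + 1) ω → (s : ℝ≥0∞) + (m : ℝ≥0) < T (n + 1) ω := by
      refine ae_all_iff.2 fun m => ?_
      set A := {ω | X s ω ∈ cemetery S Kc ∧ T n ω ≤ s ∧ (s : ℝ≥0∞) < T (n + 1) ω} with hA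
      set A' := {ω | X s ω ∈ cemetery S Kc ∧ T n ω ≤ s ∧
        (s : ℝ≥0∞) + (m : ℝ≥0) < T (n + 1) ω} with hA'
      have hmA : MeasurableSet A := ((hXm s) (measurableSet_cemetery Kc)).inter
        ((measurableSet_le (hT n) measurable_const).inter
          (measurableSet_lt measurable_const (hT (n + 1))))
      have hmA' : MeasurableSet A' := ((hXm s) (measurableSet_cemetery Kc)).inter
        ((measurableSet_le (hT n) measurable_const).inter
          (measurableSet_lt measurable_const (hT (n + 1))))
      -- With survival probability one, the integrated conditional law gives `∫ 1` over `A`.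
      have hμ : μ A' = μ A := by
        rw [hA', hjump n s m _ (measurableSet_cemetery Kc), ← hA,
          setLIntegral_congr_fun hmA (fun ω hω => hD.survival_eq_one hω.1 m)]
        simp
      have hsub : A' ⊆ A := fun ω hω => ⟨hω.1, hω.2.1, le_self_add.trans_lt hω.2.2⟩
      have hnull : μ (A \ A') = 0 := by
        rw [measure_sdiff hsub hmA'.nullMeasurableSet (measure_ne_top _ _), hμ, tsub_self]
      filter_upwards [measure_eq_zero_iff_ae_notMem.1 hnull] with ω hω h1 h2 h3
      by_contra h4
      exact hω ⟨⟨h1, h2, h3⟩, fun h => h4 h.2.2⟩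
    filter_upwards [hstep] with ω hω h1 h2 h3
    refine ENNReal.eq_top_of_forall_nnreal_le fun r => ?_
    obtain ⟨m, hm⟩ := exists_nat_ge r
    exact (ENNReal.coe_le_coe.2 hm).trans (le_add_self.trans (hω m h1 h2 h3).le)
  filter_upwards [hT0, hflow, hlast] with ω ⟨h0, hmono, hlim⟩ hfl hla t u htu ht
  -- `n + 1` is the first index whose jump time exceeds `t`; it is not zero because `T 0 = 0`.
  obtain ⟨n, hn1, hn2⟩ : ∃ n, T n ω ≤ t ∧ (t : ℝ≥0∞) < T (n + 1) ω := by
    classical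
    have hex : ∃ n, (t : ℝ≥0∞) < T n ω :=
      (hlim.eventually (lt_mem_nhds ENNReal.coe_lt_top)).exists
    obtain ⟨m, hm⟩ : ∃ m, Nat.find hex = m + 1 := by
      refine Nat.exists_eq_succ_of_ne_zero fun h => ?_
      have := Nat.find_spec hex
      rw [h, h0] at this
      exact not_lt_bot this
    refine ⟨m, not_lt.1 (Nat.find_min hex (by omega)), ?_⟩
    rw [← hm]
    exact Nat.find_spec hex
  have hk : (X (T n ω).toNNReal ω).1 ∈ Kc := by
    have := congrArg Sigma.fst (hfl n t hn1 hn2)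
    simp only at this
    rw [← this]
    exact ht
  have hconst : ∀ s : ℝ≥0, T n ω ≤ s → (s : ℝ≥0∞) < T (n + 1) ω →
      X s ω = X (T n ω).toNNReal ω := by
    intro s hs1 hs2
    have h := hfl n s hs1 hs2
    rw [(hD _ hk _).2] at h
    generalize X s ω = a at h
    generalize X (T n ω).toNNReal ω = b at h
    obtain ⟨k, a⟩ := a
    obtain ⟨k', b⟩ := b
    obtain ⟨rfl, h'⟩ := Sigma.mk.inj_iff.1 h
    exact congrArg (Sigma.mk k) (Subtype.ext (eq_of_heq h'))
  have htop : T (n + 1) ω = ⊤ := by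
    obtain ⟨q, hq0, hq1, hq2⟩ := ENNReal.lt_iff_exists_rat_btwn.1 hn2
    have hq1' : T n ω ≤ (q : ℝ).toNNReal := hn1.trans hq1.le
    refine hla n q ?_ hq1' hq2
    rw [hconst _ hq1' hq2]
    exact hk
  rw [hconst t hn1 hn2, hconst u (hn1.trans (ENNReal.coe_le_coe.2 htu))
    (htop ▸ ENNReal.coe_lt_top)]

end LocalCharacteristics

end PDMP

/-! ### Convergence of the expected costs -/

theorem mainTheorem4 {K : Type*} [Finite K] (d : K → ℕ)
    (S : ∀ k, Set (EuclideanSpace ℝ (Fin (d k)))) (Kc : Set K)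
    (D : PDMP.LocalCharacteristics S) (Dn : ℕ → PDMP.LocalCharacteristics S)
    (hD : D.IsCemetery Kc) (hDn : ∀ n, (Dn n).IsCemetery Kc)
    (x : PDMP.StateSpace S)
    {Ω : Type*} [MeasurableSpace Ω] (μ : Measure Ω) [IsProbabilityMeasure μ]
    {Ωn : ℕ → Type*} [∀ n, MeasurableSpace (Ωn n)] (μn : ∀ n, Measure (Ωn n))
    [∀ n, IsProbabilityMeasure (μn n)]
    (X : Ω → PDMP.CadlagPath (PDMP.StateSpace S))
    (Xn : ∀ n, Ωn n → PDMP.CadlagPath (PDMP.StateSpace S))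
    (hX : D.IsPDMP x μ (fun t ω => X ω t))
    (hXn : ∀ n, (Dn n).IsPDMP x (μn n) (fun t ω => Xn n ω t))
    (hconv : TendstoInDistribution Xn atTop X μn μ)
    (δ : ℝ) (hδ : 0 < δ) (ℓ Ψ : PDMP.StateSpace S → ℝ)
    (hℓ : PDMP.IsRunningReward Kc ℓ) (hΨ : PDMP.IsTerminalCost Kc Ψ)
    (hℓ_cont : Continuous ℓ) (hΨ_cont : Continuous Ψ)
    (hℓ_bdd : ∃ C, ∀ z, |ℓ z| ≤ C) (hΨ_bdd : ∃ C, ∀ z, |Ψ z| ≤ C) :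
    (∀ n, Integrable (fun ω => PDMP.pathCost Kc δ ℓ Ψ (Xn n ω)) (μn n)) ∧
    Integrable (fun ω => PDMP.pathCost Kc δ ℓ Ψ (X ω)) μ ∧
    Tendsto (fun n => ∫ ω, PDMP.pathCost Kc δ ℓ Ψ (Xn n ω) ∂(μn n)) atTop
      (𝓝 (∫ ω, PDMP.pathCost Kc δ ℓ Ψ (X ω) ∂μ)) := by

  obtain ⟨C₁, hC₁⟩ := hℓ_bdd
  obtain ⟨C₂, hC₂⟩ := hΨ_bdd
  have hg : Continuous fun z => ℓ z + δ * Ψ z := hℓ_cont.add (hΨ_cont.const_mul δ)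
  have hC : ∀ z, |ℓ z + δ * Ψ z| ≤ C₁ + δ * C₂ := fun z =>
    (abs_add_le _ _).trans (add_le_add (hC₁ z) (by
      rw [abs_mul, abs_of_pos hδ]
      exact mul_le_mul_of_nonneg_left (hC₂ z) hδ.le))
  have hFc := PDMP.continuous_discountedIntegral hδ hg hC
  have hFb := PDMP.abs_discountedIntegral_le hδ hC
  have hae : (fun ω => PDMP.pathCost Kc δ ℓ Ψ (X ω)) =ᵐ[μ]
      fun ω => PDMP.discountedIntegral δ (fun z => ℓ z + δ * Ψ z) (X ω) := by
    filter_upwards [PDMP.LocalCharacteristics.IsPDMP.ae_absorbed hD hX] with ω hω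
    exact PDMP.pathCost_eq_discountedIntegral hδ hℓ.2 hΨ.2 hg hC _ hω
  have haen : ∀ n, (fun ω => PDMP.pathCost Kc δ ℓ Ψ (Xn n ω)) =ᵐ[μn n]
      fun ω => PDMP.discountedIntegral δ (fun z => ℓ z + δ * Ψ z) (Xn n ω) := by
    intro n
    filter_upwards [PDMP.LocalCharacteristics.IsPDMP.ae_absorbed (hDn n) (hXn n)] with ω hω
    exact PDMP.pathCost_eq_discountedIntegral hδ hℓ.2 hΨ.2 hg hC _ hω
  -- Measurability comes from the continuous functional and passes to `pathCost` by almost sure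
  -- equality.
  refine ⟨fun n => ?_, ?_, ?_⟩
  · exact (Integrable.of_bound
      (hFc.measurable.comp_aemeasurable (hconv.forall_aemeasurable n)).aestronglyMeasurable _
      (Eventually.of_forall fun ω => hFb (Xn n ω))).congr (haen n).symm
  · exact (Integrable.of_bound
      (hFc.measurable.comp_aemeasurable hconv.aemeasurable_limit).aestronglyMeasurable _
      (Eventually.of_forall fun ω => hFb (X ω))).congr hae.symm
  · have h := ProbabilityMeasure.tendsto_iff_forall_integral_tendsto.1 hconv.tendsto
      (BoundedContinuousFunction.ofNormedAddCommGroup _ hFc _ hFb)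
    simp only [ProbabilityMeasure.coe_mk, BoundedContinuousFunction.coe_ofNormedAddCommGroup] at h
    rw [integral_map hconv.aemeasurable_limit hFc.measurable.aestronglyMeasurable,
      ← integral_congr_ae hae] at h
    refine h.congr fun n => ?_
    rw [integral_map (hconv.forall_aemeasurable n) hFc.measurable.aestronglyMeasurable,
      ← integral_congr_ae (haen n)]
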